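/- Let $U\subseteq\mathbb R$ be open with coordinate $x$ and let $\Gamma\in C^\infty(U,\mathbb R)$. Let $F^+=U\times\mathbb R$ with coordinates $(x,z)$ be the bundle of positive frames (the fibre coordinate is $y=e^z$). A rooted tree is a finite non-planar tree with a marked root; write $\bullet$ for the one-vertex tree and $B_+(t_1,\dots,t_n)$ for the tree obtained by joining the roots of $t_1,\dots,t_n$ to a new root. Put $\varphi^x(\bullet)=e^z$, $\varphi^z(\bullet)=-e^z\,\Gamma(x)$, and define recursively, for $t=B_+(t_1,\dots,t_n)$ and a smooth function $h$ on an open subset of $F^+$, $$\varphi_t(h)=\sum_{i_1,\dots,i_n\in\{x,z\}}\varphi^{i_1}(t_1)\cdots\varphi^{i_n}(t_n)\,\partial_{i_1}\cdots\partial_{i_n}h,\qquad \varphi^i(t)=\varphi_t(\varphi^i(\bullet)),$$ so that $\varphi_\bullet(h)=h$. Let $\mathrm{Diff}^+(U)$ be the pseudogroup of orientation preserving smooth diffeomorphisms $\psi$ from an open set $\mathrm{Dom}\,\psi\subseteq U$ onto an open subset of $U$, with lifts $\tilde\psi(x,z)=(\psi(x),z+\log\psi'(x))$ defined on $\mathrm{Dom}\,\tilde\psi=\mathrm{Dom}\,\psi\times\mathbb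 R$. Let $\mathbb k$ be $\mathbb R$ or $\mathbb C$ and let $\mathcal A=\bigoplus_{\psi}C_c^\infty(\mathrm{Dom}\,\tilde\psi,\mathbb k)\,U_\psi$ be the vector space of finite sums of monomials $fU_\psi$ (the space underlying $C_c^\infty(F^+)\rtimes\mathrm{Diff}^+(U)$). For a rooted tree $t$ and $\psi\in\mathrm{Diff}^+(U)$ put $$\gamma_\bullet(\psi)(p)=\varphi^z(\bullet)(p)+e^{z}\,\partial_x\log\psi'(x)-\varphi^z(\bullet)(\tilde\psi(p))\quad(p=(x,z)\in\mathrm{Dom}\,\tilde\psi),\qquad \gamma_t(\psi)=\varphi_t(\gamma_\bullet(\psi)),$$ and define linear operators on $\mathcal A$ by $$Y(fU_\psi)=(\partial_zf)U_\psi,\qquad X_t(fU_\psi)=\bigl(\varphi^x(t)\,\partial_xf+\varphi^z(t)\,\partial_zf\bigr)U_\psi,\qquad \delta_t(fU_\psi)=\gamma_t(\psi)\,f\,U_\psi .$$ Let $K$ be a field with an embedding $K\to\mathbb k$ (for instance $K=\mathbb Q$ or $K=\mathbb k$), and let $\mathcal L(1)$ be the $K$-linear span of $Y$, all $X_t$ and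 all $\delta_t$ ($t$ a rooted tree) in $\mathrm{End}_{\mathbb k}(\mathcal A)$. **Theorem.** $\mathcal L(1)$ is exactly the Lie subalgebra over $K$ of $\mathrm{End}_{\mathbb k}(\mathcal A)$, with the commutator bracket, that is generated by $Y$, the $X_t$ ($t$ a rooted tree) and $\delta_\bullet$; in particular it is closed under commutators. Moreover every $\delta_t$ is a $K$-linear combination of iterated commutators $[X_{t_1},[X_{t_2},\dots,[X_{t_m},\delta_\bullet]\dots]]$ with $m\ge 0$ and rooted trees $t_1,\dots,t_m$. -/

import Mathlib

open scoped ContDiff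

/-! The commutator bracket `⁅a, b⁆ = a * b - b * a`. -/
attribute [local instance 100] LieRing.ofAssociativeRing

noncomputable section

namespace TreeLie

/-! ### Non-planar rooted trees -/

/-- Planar rooted trees: a root together with the ordered list of the subtrees above it. -/
inductive PTree : Type
  | node : List PTree → PTree

/-- Elementary moves between planar representatives of the same non-planar rooted tree:
permute the children of the root, or apply a move inside one of the subtrees. -/
inductive PTree.Rel : PTree → PTree → Prop
  | perm {ts us : List PTree} : ts.Perm us → PTree.Rel (.node ts) (.node us)
  | child {t u : PTree} (ts : List PTree) :
      PTree.Rel t u → PTree.Rel (.node (t :: ts)) (.node (u :: ts))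

/-- Non-planar rooted trees: planar trees modulo the equivalence relation generated by
reordering the children of any vertex. -/
def RTree : Type := Quot PTree.Rel

/-- The tree with a single vertex. -/
def RTree.bullet : RTree := Quot.mk _ (.node [])

/-! ### Partial derivatives in the coordinates `(x, z)` of the frame bundle -/

/-- `∂/∂x` -/
def dX {E : Type*} [NormedAddCommGroup E] [NormedSpace ℝ E] (h : ℝ × ℝ → E) : ℝ × ℝ → E :=
  fun p => fderiv ℝ h p (1, 0)

/-- `∂/∂z` -/
def dZ {E : Type*} [NormedAddCommGroup E] [NormedSpace ℝ E] (h : ℝ × ℝ → E) : ℝ × ℝ → E :=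
  fun p => fderiv ℝ h p (0, 1)

/-! ### The base: a coordinate patch with a connection -/

/-- A one-dimensional coordinate patch: an open set `U ⊆ ℝ` with coordinate `x`, and a smooth
function `Γ` on it, the Christoffel symbol of the connection `dy / y + Γ(x) dx`. (The values of
`Γ` outside of `U` are irrelevant.) The bundle of positive frames is `U × ℝ` with coordinates
`(x, z)`, where `y = exp z`. -/
structure Patch where
  U : Set ℝ
  isOpen_U : IsOpen U
  Γ : ℝ → ℝ
  smooth_Γ : ContDiffOn ℝ ∞ Γ U

namespace Patch

variable (M : Patch)

/-- `φ^x(•) = dx/ds = e^z` -/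
def phiBulletX : ℝ × ℝ → ℝ := fun p => Real.exp p.2

/-- `φ^z(•) = dz/ds = - e^z Γ(x)` -/
def phiBulletZ : ℝ × ℝ → ℝ := fun p => -(Real.exp p.2 * M.Γ p.1)

mutual
/-- The operator `φ_t` on functions: for `t = B₊(t₁, …, tₙ)`,
`φ_t h = ∑_{i₁, …, iₙ ∈ {x, z}} φ^{i₁}(t₁) ⋯ φ^{iₙ}(tₙ) ∂_{i₁} ⋯ ∂_{iₙ} h`,
where `φ^i(t) = φ_t (φ^i(•))`. -/
def pphi : PTree → (ℝ × ℝ → ℝ) → (ℝ × ℝ → ℝ)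
  | .node ts, h => pphiList ts 0 0 h
/-- Auxiliary sum over the labels of a list of subtrees; `a` and `b` count how often the labels
`x` and `z` have been chosen so far. -/
def pphiList : List PTree → ℕ → ℕ → (ℝ × ℝ → ℝ) → (ℝ × ℝ → ℝ)
  | [], a, b, h => dX^[a] (dZ^[b] h)
  | t :: ts, a, b, h => fun p =>
      pphi t phiBulletX p * pphiList ts (a + 1) b h p
        + pphi t M.phiBulletZ p * pphiList ts a (b + 1) h p
end

theorem pphiList_perm {ts us : List PTree} (hp : ts.Perm us) (a b : ℕ) (h : ℝ × ℝ → ℝ) :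
    M.pphiList ts a b h = M.pphiList us a b h := by
  induction hp generalizing a b with
  | nil => rfl
  | cons t _ ih => funext p; simp only [pphiList, ih]
  | swap t u l => funext p; simp only [pphiList]; ring
  | trans _ _ ih₁ ih₂ => rw [ih₁, ih₂]

theorem pphi_rel {t u : PTree} (hr : PTree.Rel t u) : M.pphi t = M.pphi u := by
  induction hr with
  | perm hp => funext h; simp only [pphi]; exact M.pphiList_perm hp 0 0 h
  | child ts _ ih => funext h p; simp only [pphi, pphiList, ih]

/-- The operator `φ_t` attached to a non-planar rooted tree `t`. -/
def phi (t : RTree) : (ℝ × ℝ → ℝ) → (ℝ × ℝ → ℝ) :=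
  Quot.lift M.pphi (fun _ _ hr => M.pphi_rel hr) t

/-- The component `φ^x(t)`. -/
def phiX (t : RTree) : ℝ × ℝ → ℝ := M.phi t phiBulletX

/-- The component `φ^z(t)`. -/
def phiZ (t : RTree) : ℝ × ℝ → ℝ := M.phi t M.phiBulletZ

/-- An element `ψ` of the pseudogroup `Diff⁺(M)`: an orientation preserving smooth diffeomorphism
from an open subset `dom` of `U` onto an open subset of `U`. As a function on `ℝ` it is
normalised to be the identity outside of `dom`, so that two of these are equal exactly
when they are equal as partially defined maps. -/
@[ext] structure LocDiff where
  dom : Set ℝ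
  toFun : ℝ → ℝ
  isOpen_dom : IsOpen dom
  dom_subset : dom ⊆ M.U
  mapsTo : Set.MapsTo toFun dom M.U
  smooth : ContDiffOn ℝ ∞ toFun dom
  injOn : Set.InjOn toFun dom
  deriv_pos : ∀ x ∈ dom, 0 < deriv toFun x
  eq_self : ∀ x ∉ dom, toFun x = x

variable {M}

/-- The lift of `ψ` to the frame bundle: `(x, z) ↦ (ψ(x), z + log ψ'(x))`. -/
def LocDiff.lift (ψ : M.LocDiff) : ℝ × ℝ → ℝ × ℝ :=
  fun p => (ψ.toFun p.1, p.2 + Real.log (deriv ψ.toFun p.1))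

/-- The domain of the lift of `ψ`. -/
def LocDiff.liftDom (ψ : M.LocDiff) : Set (ℝ × ℝ) := ψ.dom ×ˢ Set.univ

/-- The function `γ_•(ψ)`, that is
`φ^z(•)|_p + (d/ds log ψ')|_p - φ^z(•)|_{ψ̃(p)}` with `d/ds log ψ' = e^z ∂_x log ψ'`. -/
def LocDiff.gammaBullet (ψ : M.LocDiff) : ℝ × ℝ → ℝ := fun p =>
  M.phiBulletZ p + Real.exp p.2 * deriv (fun u => Real.log (deriv ψ.toFun u)) p.1
    - M.phiBulletZ (ψ.lift p)

/-- `γ_t(ψ) = φ_t(γ_•(ψ))` -/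
def LocDiff.gamma (ψ : M.LocDiff) (t : RTree) : ℝ × ℝ → ℝ := M.phi t ψ.gammaBullet

/-! ### Smoothness facts needed to see that the operators below are well defined -/

theorem contDiffOn_dX {E : Type*} [NormedAddCommGroup E] [NormedSpace ℝ E] {O : Set (ℝ × ℝ)}
    (hO : IsOpen O) {h : ℝ × ℝ → E} (hh : ContDiffOn ℝ ∞ h O) : ContDiffOn ℝ ∞ (dX h) O :=
  (hh.fderiv_of_isOpen hO (m := ∞) (by simp)).clm_apply contDiffOn_const

theorem contDiffOn_dZ {E : Type*} [NormedAddCommGroup E] [NormedSpace ℝ E] {O : Set (ℝ × ℝ)}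
    (hO : IsOpen O) {h : ℝ × ℝ → E} (hh : ContDiffOn ℝ ∞ h O) : ContDiffOn ℝ ∞ (dZ h) O :=
  (hh.fderiv_of_isOpen hO (m := ∞) (by simp)).clm_apply contDiffOn_const

theorem contDiffOn_iter {O : Set (ℝ × ℝ)} (hO : IsOpen O) {h : ℝ × ℝ → ℝ}
    (hh : ContDiffOn ℝ ∞ h O) (a b : ℕ) : ContDiffOn ℝ ∞ (dX^[a] (dZ^[b] h)) O := by
  have h1 : ContDiffOn ℝ ∞ (dZ^[b] h) O := by
    induction b with
    | zero => exact hh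
    | succ b ih => rw [Function.iterate_succ_apply']; exact contDiffOn_dZ hO ih
  induction a with
  | zero => exact h1
  | succ a ih => rw [Function.iterate_succ_apply']; exact contDiffOn_dX hO ih

theorem contDiffOn_phiBulletX (O : Set (ℝ × ℝ)) : ContDiffOn ℝ ∞ phiBulletX O :=
  (Real.contDiff_exp.comp contDiff_snd).contDiffOn

theorem contDiffOn_phiBulletZ {O : Set (ℝ × ℝ)} (hOU : O ⊆ M.U ×ˢ Set.univ) :
    ContDiffOn ℝ ∞ M.phiBulletZ O :=
  ((Real.contDiff_exp.comp contDiff_snd).contDiffOn.mul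
    (M.smooth_Γ.comp contDiff_fst.contDiffOn fun _ hp => (hOU hp).1)).neg

mutual
theorem contDiffOn_pphi {O : Set (ℝ × ℝ)} (hO : IsOpen O) (hOU : O ⊆ M.U ×ˢ Set.univ) :
    (t : PTree) → (h : ℝ × ℝ → ℝ) → ContDiffOn ℝ ∞ h O → ContDiffOn ℝ ∞ (M.pphi t h) O
  | .node ts, h, hh => by
      simp only [pphi]; exact contDiffOn_pphiList hO hOU ts 0 0 h hh
theorem contDiffOn_pphiList {O : Set (ℝ × ℝ)} (hO : IsOpen O) (hOU : O ⊆ M.U ×ˢ Set.univ) :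
    (ts : List PTree) → (a b : ℕ) → (h : ℝ × ℝ → ℝ) → ContDiffOn ℝ ∞ h O →
      ContDiffOn ℝ ∞ (M.pphiList ts a b h) O
  | [], a, b, h, hh => by simp only [pphiList]; exact contDiffOn_iter hO hh a b
  | t :: ts, a, b, h, hh => by
      simp only [pphiList]
      exact ((contDiffOn_pphi hO hOU t _ (contDiffOn_phiBulletX O)).mul
          (contDiffOn_pphiList hO hOU ts (a + 1) b h hh)).add
        ((contDiffOn_pphi hO hOU t _ (contDiffOn_phiBulletZ hOU)).mul
          (contDiffOn_pphiList hO hOU ts a (b + 1) h hh))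
end

theorem contDiffOn_phi {O : Set (ℝ × ℝ)} (hO : IsOpen O) (hOU : O ⊆ M.U ×ˢ Set.univ)
    (t : RTree) {h : ℝ × ℝ → ℝ} (hh : ContDiffOn ℝ ∞ h O) : ContDiffOn ℝ ∞ (M.phi t h) O := by
  induction t using Quot.ind with
  | mk t => exact contDiffOn_pphi hO hOU t h hh

theorem LocDiff.isOpen_liftDom (ψ : M.LocDiff) : IsOpen ψ.liftDom := ψ.isOpen_dom.prod isOpen_univ

theorem LocDiff.liftDom_subset (ψ : M.LocDiff) : ψ.liftDom ⊆ M.U ×ˢ Set.univ :=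
  Set.prod_mono ψ.dom_subset subset_rfl

theorem LocDiff.contDiffOn_gammaBullet (ψ : M.LocDiff) :
    ContDiffOn ℝ ∞ ψ.gammaBullet ψ.liftDom := by
  have hd : ContDiffOn ℝ ∞ (deriv ψ.toFun) ψ.dom :=
    ψ.smooth.deriv_of_isOpen ψ.isOpen_dom (by simp)
  have hl : ContDiffOn ℝ ∞ (fun u => Real.log (deriv ψ.toFun u)) ψ.dom :=
    hd.log fun x hx => (ψ.deriv_pos x hx).ne'
  have hl' : ContDiffOn ℝ ∞ (deriv fun u => Real.log (deriv ψ.toFun u)) ψ.dom :=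
    hl.deriv_of_isOpen ψ.isOpen_dom (by simp)
  have hfst : Set.MapsTo Prod.fst ψ.liftDom ψ.dom := fun p hp => hp.1
  have hlift : ContDiffOn ℝ ∞ ψ.lift ψ.liftDom :=
    (ψ.smooth.comp contDiff_fst.contDiffOn hfst).prodMk
      (contDiff_snd.contDiffOn.add (hl.comp contDiff_fst.contDiffOn hfst))
  refine ((contDiffOn_phiBulletZ ψ.liftDom_subset).add ?_).sub ?_
  · exact (Real.contDiff_exp.comp contDiff_snd).contDiffOn.mul
      (hl'.comp contDiff_fst.contDiffOn hfst)
  · exact (contDiffOn_phiBulletZ (M := M) (O := M.U ×ˢ Set.univ) subset_rfl).comp hlift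
      fun p hp => ⟨ψ.mapsTo hp.1, trivial⟩

theorem LocDiff.contDiffOn_gamma (ψ : M.LocDiff) (t : RTree) :
    ContDiffOn ℝ ∞ (ψ.gamma t) ψ.liftDom :=
  contDiffOn_phi ψ.isOpen_liftDom ψ.liftDom_subset t ψ.contDiffOn_gammaBullet

/-! ### The space `𝒜` -/

section Operators

variable (𝕜 : Type*) [RCLike 𝕜]

/-- `C_c^∞(Dom ψ̃)`: smooth compactly supported functions on the domain of the lift of `ψ`,
extended by zero. -/
def Cc (ψ : M.LocDiff) : Submodule 𝕜 (ℝ × ℝ → 𝕜) where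
  carrier := {f | ContDiff ℝ ∞ f ∧ HasCompactSupport f ∧ tsupport f ⊆ ψ.liftDom}
  add_mem' := fun {f g} hf hg => ⟨hf.1.add hg.1, hf.2.1.add hg.2.1,
    (tsupport_add f g).trans (Set.union_subset hf.2.2 hg.2.2)⟩
  zero_mem' := ⟨contDiff_const, HasCompactSupport.zero, by simp [tsupport]⟩
  smul_mem' := fun c f hf => ⟨contDiff_const.smul hf.1, hf.2.1.smul_left (f := fun _ => c),
    (closure_mono (Function.support_const_smul_subset c f)).trans hf.2.2⟩

variable (M) in
/-- The underlying vector space of `𝒜 = C_c^∞(F⁺M) ⋊ Diff⁺(M)`: finite sums `∑_ψ f_ψ U_ψ` of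
monomials with `ψ ∈ Diff⁺(M)` and `f_ψ ∈ C_c^∞(Dom ψ̃)`. Such a sum is stored as the finitely
supported family of its coefficients `ψ ↦ f_ψ`. -/
def Alg : Submodule 𝕜 (M.LocDiff → ℝ × ℝ → 𝕜) where
  carrier := {a | (Function.support a).Finite ∧ ∀ ψ, a ψ ∈ Cc 𝕜 ψ}
  add_mem' := fun {a b} ha hb => ⟨(ha.1.union hb.1).subset (Function.support_add a b),
    fun ψ => (Cc 𝕜 ψ).add_mem (ha.2 ψ) (hb.2 ψ)⟩
  zero_mem' := ⟨by simp, fun ψ => (Cc 𝕜 ψ).zero_mem⟩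
  smul_mem' := fun c a ha => ⟨ha.1.subset (Function.support_const_smul_subset c a),
    fun ψ => (Cc 𝕜 ψ).smul_mem c (ha.2 ψ)⟩

variable {𝕜}

theorem smul_mem_Cc {ψ : M.LocDiff} {g : ℝ × ℝ → ℝ} (hg : ContDiffOn ℝ ∞ g ψ.liftDom)
    {f : ℝ × ℝ → 𝕜} (hf : f ∈ Cc 𝕜 ψ) : (fun p => g p • f p) ∈ Cc 𝕜 ψ := by
  have hs : tsupport (fun p => g p • f p) ⊆ tsupport f := tsupport_smul_subset_right g f
  refine ⟨?_, hf.2.1.mono' ((subset_tsupport _).trans hs), hs.trans hf.2.2⟩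
  refine contDiff_iff_contDiffAt.2 fun p => ?_
  by_cases hp : p ∈ tsupport (fun p => g p • f p)
  · exact (hg.contDiffAt (ψ.isOpen_liftDom.mem_nhds (hf.2.2 (hs hp)))).smul hf.1.contDiffAt
  · exact (contDiffAt_const (c := (0 : 𝕜))).congr_of_eventuallyEq
      (notMem_tsupport_iff_eventuallyEq.1 hp)

theorem fderiv_apply_mem_Cc {ψ : M.LocDiff} {f : ℝ × ℝ → 𝕜} (hf : f ∈ Cc 𝕜 ψ) (v : ℝ × ℝ) :
    (fun p => fderiv ℝ f p v) ∈ Cc 𝕜 ψ :=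
  ⟨(hf.1.fderiv_right (m := ∞) (by simp)).clm_apply contDiff_const, hf.2.1.fderiv_apply ℝ v,
    (tsupport_fderiv_apply_subset ℝ v).trans hf.2.2⟩

/-- `∂/∂x` on `C_c^∞(Dom ψ̃)` -/
def dXc (ψ : M.LocDiff) : Cc 𝕜 ψ →ₗ[𝕜] Cc 𝕜 ψ where
  toFun f := ⟨dX f.1, fderiv_apply_mem_Cc f.2 _⟩
  map_add' f g := by
    ext p
    simp [dX, fderiv_add (f.2.1.differentiable (by simp)).differentiableAt
      (g.2.1.differentiable (by simp)).differentiableAt]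
  map_smul' c f := by
    ext p
    simp [dX, fderiv_const_smul (f.2.1.differentiable (by simp)).differentiableAt]

/-- `∂/∂z` on `C_c^∞(Dom ψ̃)` -/
def dZc (ψ : M.LocDiff) : Cc 𝕜 ψ →ₗ[𝕜] Cc 𝕜 ψ where
  toFun f := ⟨dZ f.1, fderiv_apply_mem_Cc f.2 _⟩
  map_add' f g := by
    ext p
    simp [dZ, fderiv_add (f.2.1.differentiable (by simp)).differentiableAt
      (g.2.1.differentiable (by simp)).differentiableAt]
  map_smul' c f := by
    ext p
    simp [dZ, fderiv_const_smul (f.2.1.differentiable (by simp)).differentiableAt]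

/-- Multiplication by a real function that is smooth on `Dom ψ̃`. -/
def mulc (ψ : M.LocDiff) (g : ℝ × ℝ → ℝ) (hg : ContDiffOn ℝ ∞ g ψ.liftDom) :
    Cc 𝕜 ψ →ₗ[𝕜] Cc 𝕜 ψ where
  toFun f := ⟨fun p => g p • f.1 p, smul_mem_Cc hg f.2⟩
  map_add' f f' := by ext p; simp
  map_smul' c f := by ext p; simp

/-- The operator `∑_ψ f_ψ U_ψ ↦ ∑_ψ T_ψ(f_ψ) U_ψ` on `𝒜`. -/
def coeffwise (T : ∀ ψ : M.LocDiff, Cc 𝕜 ψ →ₗ[𝕜] Cc 𝕜 ψ) : Module.End 𝕜 (M.Alg 𝕜) where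
  toFun a := ⟨fun ψ => (T ψ ⟨a.1 ψ, a.2.2 ψ⟩ : Cc 𝕜 ψ).1, by
    refine ⟨a.2.1.subset fun ψ hψ h0 => hψ ?_, fun ψ => (T ψ ⟨a.1 ψ, a.2.2 ψ⟩).2⟩
    have h1 : (⟨a.1 ψ, a.2.2 ψ⟩ : Cc 𝕜 ψ) = 0 := Subtype.ext h0
    simp [h1]⟩
  map_add' a b := by
    refine Subtype.ext (funext fun ψ => ?_)
    exact congrArg Subtype.val ((T ψ).map_add ⟨a.1 ψ, a.2.2 ψ⟩ ⟨b.1 ψ, b.2.2 ψ⟩)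
  map_smul' c a := by
    refine Subtype.ext (funext fun ψ => ?_)
    exact congrArg Subtype.val ((T ψ).map_smul c ⟨a.1 ψ, a.2.2 ψ⟩)

variable (M 𝕜)

/-- `Y (f U_ψ) = (∂f/∂z) U_ψ` -/
def opY : Module.End 𝕜 (M.Alg 𝕜) := coeffwise fun ψ => dZc ψ

/-- `X_t (f U_ψ) = (φ^x(t) ∂f/∂x + φ^z(t) ∂f/∂z) U_ψ` -/
def opX (t : RTree) : Module.End 𝕜 (M.Alg 𝕜) := coeffwise fun ψ =>
  mulc ψ (M.phiX t) (contDiffOn_phi ψ.isOpen_liftDom ψ.liftDom_subset t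
      (contDiffOn_phiBulletX _)) ∘ₗ dXc ψ
    + mulc ψ (M.phiZ t) (contDiffOn_phi ψ.isOpen_liftDom ψ.liftDom_subset t
      (contDiffOn_phiBulletZ ψ.liftDom_subset)) ∘ₗ dZc ψ

/-- `δ_t (f U_ψ) = γ_t(ψ) f U_ψ` -/
def opDelta (t : RTree) : Module.End 𝕜 (M.Alg 𝕜) := coeffwise fun ψ =>
  mulc ψ (ψ.gamma t) (ψ.contDiffOn_gamma t)

/-- The linear span over `K` of `Y`, all `X_t` and all `δ_t`, the underlying vector space
of the Lie algebra `L(1)`. -/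
def L1 (K : Type*) [Field K] [Algebra K 𝕜] : Submodule K (Module.End 𝕜 (M.Alg 𝕜)) :=
  Submodule.span K ({M.opY 𝕜} ∪ Set.range (M.opX 𝕜) ∪ Set.range (M.opDelta 𝕜))

/-- The iterated commutator `[X_{t₁}, [X_{t₂}, … [X_{tₙ}, δ_•] … ]]`. -/
def iterBracket (ts : List RTree) : Module.End 𝕜 (M.Alg 𝕜) :=
  ts.foldr (fun t D => ⁅M.opX 𝕜 t, D⁆) (M.opDelta 𝕜 RTree.bullet)

end Operators

end Patch

end TreeLie

end

-- Let `V_t` be the vector field with components `φ^x(t)` and `φ^z(t)`. Everything rests on one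
-- identity: differentiating `φ_t h` along `V_s` gives the sum of `φ_u h` over all trees `u`
-- obtained by joining the root of `s` to a vertex of `t` (`fderiv_pphi_field`). By the product rule
-- the derivative falls either on `∂_{i₁} ⋯ ∂_{iₙ} h`, which adds `s` as a branch at the root, or on
-- a factor `φ^i(t_k)`, which grafts `s` onto `t_k` by recursion. With `h = φ^i(•)` this gives
-- `[X_s, X_t]` as a difference of two grafting sums; with `h = γ_•(ψ)` it gives `[X_s, δ_t]` as a
-- grafting sum. The functions `φ^i(•)` and `γ_•(ψ)` are `e^z` times functions of `x`, so `φ_t` of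
-- them scales like `e^{|t|z}`, and `Y` acts on `X_t` and `δ_t` by the number `|t|` of vertices
-- (`dZ_pphi`). The `δ_t` are multiplications and commute. All coefficients in these relations are
-- integers, so the span is closed under brackets over any `K`. The relation for `[X_s, δ_t]` can be
-- solved for the `δ` of the tree with `s` added at the root, and this produces every `δ_t` from
-- `δ_•` (`mem_span_iterated_lie`).

namespace TreeLie

/-! ### Grafting of planar trees -/

mutual
/-- All trees obtained by joining the root of `s` to a vertex of the given tree. -/
def PTree.graft (s : PTree) : PTree → List PTree
  | .node ts => .node (s :: ts) :: (PTree.graftList s ts).map .node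
/-- All forests obtained by joining the root of `s` to a vertex of the given forest. -/
def PTree.graftList (s : PTree) : List PTree → List (List PTree)
  | [] => []
  | t :: ts => (PTree.graft s t).map (· :: ts) ++ (PTree.graftList s ts).map (t :: ·)
end

/-- Grafting onto the vertices of a forest enlarges its trees but adds no root. The number of
branches at the root can therefore serve as the induction measure in `mem_span_iterated_lie`. -/
theorem PTree.length_of_mem_graftList (s : PTree) {ts us : List PTree}
    (h : us ∈ PTree.graftList s ts) : us.length = ts.length := by
  induction ts generalizing us with
  | nil => simp [PTree.graftList] at h
  | cons t ts ih =>
    simp only [PTree.graftList, List.mem_append, List.mem_map] at h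
    rcases h with ⟨u, -, rfl⟩ | ⟨vs, hv, rfl⟩
    · rfl
    · simp [ih hv]

mutual
/-- The number of vertices of a tree. -/
def PTree.size : PTree → ℕ
  | .node ts => PTree.sizeList ts + 1
/-- The number of vertices of a forest. -/
def PTree.sizeList : List PTree → ℕ
  | [] => 0
  | t :: ts => PTree.size t + PTree.sizeList ts
end

/-! ### Partial derivatives -/

section Partial

variable {E : Type*} [NormedAddCommGroup E] [NormedSpace ℝ E]

theorem fderiv_apply_mk (h : ℝ × ℝ → E) (p : ℝ × ℝ) (a b : ℝ) :
    fderiv ℝ h p (a, b) = a • dX h p + b • dZ h p := by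
  have : (a, b) = a • ((1 : ℝ), (0 : ℝ)) + b • ((0 : ℝ), (1 : ℝ)) := by simp
  rw [this, map_add, map_smul, map_smul, dX, dZ]

theorem fderiv_congr_of_eqOn {O : Set (ℝ × ℝ)} (hO : IsOpen O) {f g : ℝ × ℝ → E}
    (h : Set.EqOn f g O) {p : ℝ × ℝ} (hp : p ∈ O) : fderiv ℝ f p = fderiv ℝ g p :=
  (h.eventuallyEq_of_mem (hO.mem_nhds hp)).fderiv_eq

theorem eqOn_dX {O : Set (ℝ × ℝ)} (hO : IsOpen O) {f g : ℝ × ℝ → E}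
    (h : Set.EqOn f g O) : Set.EqOn (dX f) (dX g) O := fun _ hp => by
  rw [dX, dX, fderiv_congr_of_eqOn hO h hp]

theorem eqOn_dZ {O : Set (ℝ × ℝ)} (hO : IsOpen O) {f g : ℝ × ℝ → E}
    (h : Set.EqOn f g O) : Set.EqOn (dZ f) (dZ g) O := fun _ hp => by
  rw [dZ, dZ, fderiv_congr_of_eqOn hO h hp]

theorem eqOn_iter {O : Set (ℝ × ℝ)} (hO : IsOpen O) {f g : ℝ × ℝ → E}
    (h : Set.EqOn f g O) (a b : ℕ) : Set.EqOn (dX^[a] (dZ^[b] f)) (dX^[a] (dZ^[b] g)) O := by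
  have hb : Set.EqOn (dZ^[b] f) (dZ^[b] g) O := by
    induction b with
    | zero => exact h
    | succ b ih => simp only [Function.iterate_succ_apply']; exact eqOn_dZ hO ih
  induction a with
  | zero => exact hb
  | succ a ih => simp only [Function.iterate_succ_apply']; exact eqOn_dX hO ih

/-- Derivative of the derivative of `f` along a vector field. -/
theorem fderiv_fderiv_field {f : ℝ × ℝ → E} {p : ℝ × ℝ} (hf : ContDiffAt ℝ ∞ f p)
    {V : ℝ × ℝ → ℝ × ℝ} (hV : DifferentiableAt ℝ V p) (w : ℝ × ℝ) :
    fderiv ℝ (fun q => fderiv ℝ f q (V q)) p w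
      = fderiv ℝ (fderiv ℝ f) p w (V p) + fderiv ℝ f p (fderiv ℝ V p w) := by
  have hd : DifferentiableAt ℝ (fderiv ℝ f) p :=
    (hf.fderiv_right (m := ∞) (by simp)).differentiableAt (by simp)
  rw [fderiv_clm_apply hd hV]
  simp [add_comm]

theorem fderiv_fderiv_comm {f : ℝ × ℝ → E} {p : ℝ × ℝ} (hf : ContDiffAt ℝ ∞ f p)
    (v w : ℝ × ℝ) : fderiv ℝ (fderiv ℝ f) p v w = fderiv ℝ (fderiv ℝ f) p w v :=
  (hf.isSymmSndFDerivAt (by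
    rw [minSmoothness_of_isRCLikeNormedField]
    exact WithTop.coe_le_coe.2 (le_top (a := (2 : ℕ∞))))).eq v w

/-- The commutator of the derivatives along two vector fields. -/
theorem fderiv_fderiv_sub {f : ℝ × ℝ → E} {p : ℝ × ℝ} (hf : ContDiffAt ℝ ∞ f p)
    {V W : ℝ × ℝ → ℝ × ℝ} (hV : DifferentiableAt ℝ V p) (hW : DifferentiableAt ℝ W p) :
    fderiv ℝ (fun q => fderiv ℝ f q (W q)) p (V p) - fderiv ℝ (fun q => fderiv ℝ f q (V q)) p (W p)
      = fderiv ℝ f p (fderiv ℝ W p (V p) - fderiv ℝ V p (W p)) := by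
  rw [fderiv_fderiv_field hf hW, fderiv_fderiv_field hf hV, fderiv_fderiv_comm hf (V p) (W p),
    map_sub]
  abel

theorem dZ_dX {O : Set (ℝ × ℝ)} (hO : IsOpen O) {f : ℝ × ℝ → E} (hf : ContDiffOn ℝ ∞ f O) :
    Set.EqOn (dZ (dX f)) (dX (dZ f)) O := fun p hp => by
  have h := hf.contDiffAt (hO.mem_nhds hp)
  change fderiv ℝ (fun q => fderiv ℝ f q (1, 0)) p (0, 1)
    = fderiv ℝ (fun q => fderiv ℝ f q (0, 1)) p (1, 0)
  rw [fderiv_fderiv_field h (differentiableAt_const _),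
    fderiv_fderiv_field h (differentiableAt_const _), fderiv_fderiv_comm h]
  simp

/-- `pphiList` stores mixed derivatives in the order `∂_x^a ∂_z^b`; a further `∂_z` has to be moved
past the `∂_x` to restore that form. -/
theorem dZ_iter {O : Set (ℝ × ℝ)} (hO : IsOpen O) {h : ℝ × ℝ → ℝ} (hh : ContDiffOn ℝ ∞ h O)
    (a b : ℕ) : Set.EqOn (dZ (dX^[a] (dZ^[b] h))) (dX^[a] (dZ^[b + 1] h)) O := by
  induction a with
  | zero => intro p _; simp only [Function.iterate_succ_apply', Function.iterate_zero, id]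
  | succ a ih =>
    rw [Function.iterate_succ_apply', Function.iterate_succ_apply']
    exact (dZ_dX hO (Patch.contDiffOn_iter hO hh a b)).trans (eqOn_dX hO ih)

end Partial

-- Derivatives of `φ_t` along the vector fields of trees.

namespace Patch

variable (M : Patch)

/-- The vector field `φ^x(t) ∂_x + φ^z(t) ∂_z`. -/
noncomputable def field (t : PTree) : ℝ × ℝ → ℝ × ℝ :=
  fun p => (M.pphi t phiBulletX p, M.pphi t M.phiBulletZ p)

variable {M} {O : Set (ℝ × ℝ)}

theorem differentiableAt_pphi (hO : IsOpen O) (hOU : O ⊆ M.U ×ˢ Set.univ) (t : PTree)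
    {h : ℝ × ℝ → ℝ} (hh : ContDiffOn ℝ ∞ h O) {p : ℝ × ℝ} (hp : p ∈ O) :
    DifferentiableAt ℝ (M.pphi t h) p :=
  ((contDiffOn_pphi hO hOU t h hh).contDiffAt (hO.mem_nhds hp)).differentiableAt (by simp)

theorem differentiableAt_pphiList (hO : IsOpen O) (hOU : O ⊆ M.U ×ˢ Set.univ) (ts : List PTree)
    (a b : ℕ) {h : ℝ × ℝ → ℝ} (hh : ContDiffOn ℝ ∞ h O) {p : ℝ × ℝ} (hp : p ∈ O) :
    DifferentiableAt ℝ (M.pphiList ts a b h) p :=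
  ((contDiffOn_pphiList hO hOU ts a b h hh).contDiffAt (hO.mem_nhds hp)).differentiableAt
    (by simp)

/-- The product rule for the recursion defining `pphiList`. -/
theorem fderiv_pphiList_cons (hO : IsOpen O) (hOU : O ⊆ M.U ×ˢ Set.univ) (t : PTree)
    (ts : List PTree) (a b : ℕ) {h : ℝ × ℝ → ℝ} (hh : ContDiffOn ℝ ∞ h O) {p : ℝ × ℝ}
    (hp : p ∈ O) (v : ℝ × ℝ) :
    fderiv ℝ (M.pphiList (t :: ts) a b h) p v
      = fderiv ℝ (M.pphi t phiBulletX) p v * M.pphiList ts (a + 1) b h p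
        + M.pphi t phiBulletX p * fderiv ℝ (M.pphiList ts (a + 1) b h) p v
        + (fderiv ℝ (M.pphi t M.phiBulletZ) p v * M.pphiList ts a (b + 1) h p
        + M.pphi t M.phiBulletZ p * fderiv ℝ (M.pphiList ts a (b + 1) h) p v) := by
  have h1 := (differentiableAt_pphi hO hOU t (contDiffOn_phiBulletX O) hp).hasFDerivAt
  have h2 := (differentiableAt_pphi hO hOU t (contDiffOn_phiBulletZ hOU) hp).hasFDerivAt
  have h3 := (differentiableAt_pphiList hO hOU ts (a + 1) b hh hp).hasFDerivAt
  have h4 := (differentiableAt_pphiList hO hOU ts a (b + 1) hh hp).hasFDerivAt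
  have h5 : HasFDerivAt (M.pphiList (t :: ts) a b h) _ p := (h1.mul h3).add (h2.mul h4)
  rw [h5.fderiv]
  simp only [_root_.add_apply, _root_.smul_apply, smul_eq_mul]
  ring

mutual
/-- Differentiating `φ_t h` along the vector field of `s` grafts `s` onto `t`. -/
theorem fderiv_pphi_field (hO : IsOpen O) (hOU : O ⊆ M.U ×ˢ Set.univ) (s : PTree)
    {p : ℝ × ℝ} (hp : p ∈ O) : (t : PTree) → (h : ℝ × ℝ → ℝ) → ContDiffOn ℝ ∞ h O →
    fderiv ℝ (M.pphi t h) p (M.field s p) = ((s.graft t).map fun u => M.pphi u h p).sum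
  | .node ts, h, hh => by
      have e : M.pphi (.node ts) h = M.pphiList ts 0 0 h := by simp only [pphi]
      rw [e, fderiv_pphiList_field hO hOU s hp ts 0 0 h hh]
      simp [PTree.graft, pphi, Function.comp_def]
theorem fderiv_pphiList_field (hO : IsOpen O) (hOU : O ⊆ M.U ×ˢ Set.univ) (s : PTree)
    {p : ℝ × ℝ} (hp : p ∈ O) : (ts : List PTree) → (a b : ℕ) → (h : ℝ × ℝ → ℝ) →
    ContDiffOn ℝ ∞ h O →
    fderiv ℝ (M.pphiList ts a b h) p (M.field s p)
      = M.pphiList (s :: ts) a b h p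
        + ((PTree.graftList s ts).map fun us => M.pphiList us a b h p).sum
  | [], a, b, h, hh => by
      have e : M.pphiList [] a b h = dX^[a] (dZ^[b] h) := by simp only [pphiList]
      -- The two components of the field of `s` raise `a` or `b` by one: this is the recursion of
      -- `pphiList` for the forest `[s]`.
      rw [e, field, fderiv_apply_mk, dZ_iter hO hh a b hp]
      simp [pphiList, PTree.graftList, Function.iterate_succ_apply']
  | t :: ts, a, b, h, hh => by
      -- The recursive calls on `ts` produce `s :: ts` below the label chosen for `t`. The swap puts
      -- `t` in front of `s`, so that unfolding the right-hand side also expands `t` first.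
      rw [fderiv_pphiList_cons hO hOU t ts a b hh hp,
        fderiv_pphi_field hO hOU s hp t _ (contDiffOn_phiBulletX O),
        fderiv_pphi_field hO hOU s hp t _ (contDiffOn_phiBulletZ hOU),
        fderiv_pphiList_field hO hOU s hp ts (a + 1) b h hh,
        fderiv_pphiList_field hO hOU s hp ts a (b + 1) h hh,
        M.pphiList_perm (List.Perm.swap t s ts)]
      simp only [PTree.graftList, List.map_append, List.map_map, List.sum_append,
        Function.comp_def, pphiList, List.sum_map_add, List.sum_map_mul_left,
        List.sum_map_mul_right]
      ring
end

-- Homogeneity in `e^z`.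

theorem dZ_phiBulletX (q : ℝ × ℝ) : dZ phiBulletX q = phiBulletX q := by
  have : HasFDerivAt phiBulletX _ q := (hasFDerivAt_snd (𝕜 := ℝ) (p := q)).exp
  simp [dZ, this.fderiv, phiBulletX]

theorem dZ_exp_mul {g : ℝ → ℝ} {q : ℝ × ℝ} (hg : DifferentiableAt ℝ g q.1) :
    dZ (fun p : ℝ × ℝ => Real.exp p.2 * g p.1) q = Real.exp q.2 * g q.1 := by
  have h1 : HasFDerivAt (fun q : ℝ × ℝ => g q.1) _ q :=
    hg.hasFDerivAt.comp q (hasFDerivAt_fst (𝕜 := ℝ) (p := q))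
  have h2 : HasFDerivAt (fun p : ℝ × ℝ => Real.exp p.2 * g p.1) _ q :=
    ((hasFDerivAt_snd (𝕜 := ℝ) (p := q)).exp).mul h1
  rw [dZ, h2.fderiv]
  simp [mul_comm]

theorem dZ_phiBulletZ {q : ℝ × ℝ} (hq : q.1 ∈ M.U) : dZ M.phiBulletZ q = M.phiBulletZ q := by
  have hΓ : DifferentiableAt ℝ (fun x => -M.Γ x) q.1 :=
    ((M.smooth_Γ.contDiffAt (M.isOpen_U.mem_nhds hq)).differentiableAt (by simp)).neg
  have e : M.phiBulletZ = fun p => Real.exp p.2 * -M.Γ p.1 := by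
    funext p; simp [phiBulletZ]
  rw [e, dZ_exp_mul hΓ]

theorem LocDiff.dZ_gammaBullet (ψ : M.LocDiff) :
    Set.EqOn (dZ ψ.gammaBullet) ψ.gammaBullet ψ.liftDom := by
  have hd : ContDiffOn ℝ ∞ (deriv ψ.toFun) ψ.dom :=
    ψ.smooth.deriv_of_isOpen ψ.isOpen_dom (by simp)
  have hl : ContDiffOn ℝ ∞ (fun u => Real.log (deriv ψ.toFun u)) ψ.dom :=
    hd.log fun x hx => (ψ.deriv_pos x hx).ne'
  have hl' : ContDiffOn ℝ ∞ (deriv fun u => Real.log (deriv ψ.toFun u)) ψ.dom :=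
    hl.deriv_of_isOpen ψ.isOpen_dom (by simp)
  -- The lift replaces `e^z` by `e^{z + log ψ'} = e^z ψ'`, so `e^z` factors out of all three terms
  -- of `γ_•(ψ)`; `g` is the remaining function of `x` alone.
  set g : ℝ → ℝ := fun x => -M.Γ x + deriv (fun u => Real.log (deriv ψ.toFun u)) x
    + deriv ψ.toFun x * M.Γ (ψ.toFun x) with hg
  have hgs : ContDiffOn ℝ ∞ g ψ.dom :=
    ((M.smooth_Γ.mono ψ.dom_subset).neg.add hl').add
      (hd.mul (M.smooth_Γ.comp ψ.smooth ψ.mapsTo))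
  have e : Set.EqOn ψ.gammaBullet (fun p => Real.exp p.2 * g p.1) ψ.liftDom := fun p hp => by
    simp only [LocDiff.gammaBullet, phiBulletZ, LocDiff.lift, hg, Real.exp_add,
      Real.exp_log (ψ.deriv_pos p.1 hp.1)]
    ring
  intro p hp
  rw [eqOn_dZ ψ.isOpen_liftDom e hp, e hp, dZ_exp_mul]
  exact (hgs.contDiffAt (ψ.isOpen_dom.mem_nhds hp.1)).differentiableAt (by simp)

mutual
/-- If `h` is homogeneous of degree one in `e^z`, then `φ_t h` is homogeneous of degree `|t|`. -/
theorem dZ_pphi (hO : IsOpen O) (hOU : O ⊆ M.U ×ˢ Set.univ) {p : ℝ × ℝ} (hp : p ∈ O) :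
    (t : PTree) → (h : ℝ × ℝ → ℝ) → ContDiffOn ℝ ∞ h O → Set.EqOn (dZ h) h O →
    dZ (M.pphi t h) p = t.size * M.pphi t h p
  | .node ts, h, hh, hd => by
      have e : M.pphi (.node ts) h = M.pphiList ts 0 0 h := by simp only [pphi]
      rw [e, dZ_pphiList hO hOU hp ts 0 0 h hh hd]
      simp [PTree.size]
-- Degrees add over the factors: each branch contributes its size, and the derivatives of `h` keep
-- the degree one of `h`. That one accounts for the root in `PTree.size`.
theorem dZ_pphiList (hO : IsOpen O) (hOU : O ⊆ M.U ×ˢ Set.univ) {p : ℝ × ℝ} (hp : p ∈ O) :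
    (ts : List PTree) → (a b : ℕ) → (h : ℝ × ℝ → ℝ) → ContDiffOn ℝ ∞ h O →
    Set.EqOn (dZ h) h O →
    dZ (M.pphiList ts a b h) p = (PTree.sizeList ts + 1) * M.pphiList ts a b h p
  | [], a, b, h, hh, hd => by
      have e : M.pphiList [] a b h = dX^[a] (dZ^[b] h) := by simp only [pphiList]
      -- The extra `∂_z` is placed innermost, directly on `h`, where the hypothesis on `h` absorbs
      -- it.
      rw [e, dZ_iter hO hh a b hp, Function.iterate_succ_apply, eqOn_iter hO hd a b hp]
      simp [PTree.sizeList]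
  | t :: ts, a, b, h, hh, hd => by
      have hX : Set.EqOn (dZ phiBulletX) phiBulletX O := fun q _ => dZ_phiBulletX q
      have hZ : Set.EqOn (dZ M.phiBulletZ) M.phiBulletZ O := fun q hq => dZ_phiBulletZ (hOU hq).1
      have i1 := dZ_pphi hO hOU hp t _ (contDiffOn_phiBulletX O) hX
      have i2 := dZ_pphi hO hOU hp t _ (contDiffOn_phiBulletZ hOU) hZ
      have i3 := dZ_pphiList hO hOU hp ts (a + 1) b h hh hd
      have i4 := dZ_pphiList hO hOU hp ts a (b + 1) h hh hd
      have i5 := fderiv_pphiList_cons hO hOU t ts a b hh hp (0, 1)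
      simp only [dZ] at i1 i2 i3 i4 ⊢
      rw [i5, i1, i2, i3, i4]
      simp only [PTree.sizeList, pphiList]
      push_cast
      ring
end

end Patch
end TreeLie

namespace TreeLie

/-- The non-planar tree represented by a planar tree. -/
def RTree.mk (t : PTree) : RTree := Quot.mk _ t

theorem RTree.mk_surjective (t : RTree) : ∃ u, RTree.mk u = t := Quot.exists_rep t

/-! ### Lie algebras with grafting relations -/

section Grafting

variable {K L : Type*} [Field K] [LieRing L] [LieAlgebra K L] {S : Submodule K L}

theorem lie_mem_of_mem_span {G : Set L} {x : L} (h : ∀ y ∈ G, ⁅x, y⁆ ∈ S) {y : L}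
    (hy : y ∈ Submodule.span K G) : ⁅x, y⁆ ∈ S := by
  have : Submodule.span K G ≤ S.comap (LieAlgebra.ad K L x : L →ₗ[K] L) :=
    Submodule.span_le.2 h
  exact this hy

theorem lie_mem_comm {x y : L} (h : ⁅x, y⁆ ∈ S) : ⁅y, x⁆ ∈ S := by
  rw [← lie_skew]; exact neg_mem h

theorem lie_mem_span_of_forall {G : Set L}
    (h : ∀ x ∈ G, ∀ y ∈ G, ⁅x, y⁆ ∈ Submodule.span K G) {x y : L}
    (hx : x ∈ Submodule.span K G) (hy : y ∈ Submodule.span K G) :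
    ⁅x, y⁆ ∈ Submodule.span K G :=
  lie_mem_of_mem_span
    (fun y hy => lie_mem_comm (lie_mem_of_mem_span (fun x hx => h y hy x hx) hx)) hy

variable {Y : L} {X δ : RTree → L}

/-- If bracketing with `X s` grafts `s`, then all `δ t` are combinations of iterated brackets:
grafting the first branch `s` onto the tree with the remaining branches gives the whole tree and
trees with fewer branches at the root. -/
theorem mem_span_iterated_lie
    (hXδ : ∀ s t, ⁅X (.mk s), δ (.mk t)⁆ = ((PTree.graft s t).map fun u => δ (.mk u)).sum)
    (t : RTree) :
    δ t ∈ Submodule.span K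
      (Set.range fun ts : List RTree => ts.foldr (fun t D => ⁅X t, D⁆) (δ .bullet)) := by
  have key : ∀ (n : ℕ) (ts : List PTree), ts.length = n → δ (.mk (.node ts)) ∈ Submodule.span K
      (Set.range fun ts : List RTree => ts.foldr (fun t D => ⁅X t, D⁆) (δ .bullet)) := by
    intro n
    induction n with
    | zero =>
      intro ts h
      obtain rfl := List.length_eq_zero_iff.1 h
      exact Submodule.subset_span ⟨[], rfl⟩
    | succ n ih =>
      rintro (_ | ⟨s, ts⟩) h
      · simp at h
      have hts : ts.length = n := by simpa using h
      have hb := hXδ s (.node ts)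
      rw [PTree.graft, List.map_cons, List.sum_cons, List.map_map] at hb
      -- The head of the grafting sum is the wanted tree, with `n + 1` branches; all other terms
      -- still have `n` branches, so `ih` covers them.
      rw [← sub_eq_of_eq_add hb]
      refine sub_mem (lie_mem_of_mem_span ?_ (ih ts hts)) (list_sum_mem fun D hD => ?_)
      · rintro _ ⟨us, rfl⟩
        exact Submodule.subset_span ⟨.mk s :: us, rfl⟩
      · obtain ⟨us, hus, rfl⟩ := List.mem_map.1 hD
        exact ih us ((PTree.length_of_mem_graftList s hus).trans hts)
  obtain ⟨⟨ts⟩, rfl⟩ := RTree.mk_surjective t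
  exact key _ ts rfl

/-- Pure Lie algebra: the relations on generators close the span under brackets, which bounds the
generated subalgebra from above; the iterated brackets place every `δ t` in it. -/
theorem lieSpan_eq_span_of_grafting
    (hYX : ∀ t, ⁅Y, X (.mk t)⁆ = t.size • X (.mk t))
    (hYδ : ∀ t, ⁅Y, δ (.mk t)⁆ = t.size • δ (.mk t))
    (hXX : ∀ s t, ⁅X (.mk s), X (.mk t)⁆ = ((PTree.graft s t).map fun u => X (.mk u)).sum
      - ((PTree.graft t s).map fun u => X (.mk u)).sum)
    (hXδ : ∀ s t, ⁅X (.mk s), δ (.mk t)⁆ = ((PTree.graft s t).map fun u => δ (.mk u)).sum)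
    (hδδ : ∀ s t, ⁅δ (.mk s), δ (.mk t)⁆ = 0) :
    (LieSubalgebra.lieSpan K L ({Y} ∪ Set.range X ∪ {δ .bullet})).toSubmodule
      = Submodule.span K ({Y} ∪ Set.range X ∪ Set.range δ) := by
  have mX (t) : X t ∈ Submodule.span K ({Y} ∪ Set.range X ∪ Set.range δ) :=
    Submodule.subset_span (.inl (.inr ⟨t, rfl⟩))
  have mδ (t) : δ t ∈ Submodule.span K ({Y} ∪ Set.range X ∪ Set.range δ) :=
    Submodule.subset_span (.inr ⟨t, rfl⟩)
  have sX (l : List PTree) : (l.map fun u => X (.mk u)).sum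
      ∈ Submodule.span K ({Y} ∪ Set.range X ∪ Set.range δ) :=
    list_sum_mem fun D hD => by obtain ⟨u, -, rfl⟩ := List.mem_map.1 hD; exact mX _
  have sδ (l : List PTree) : (l.map fun u => δ (.mk u)).sum
      ∈ Submodule.span K ({Y} ∪ Set.range X ∪ Set.range δ) :=
    list_sum_mem fun D hD => by obtain ⟨u, -, rfl⟩ := List.mem_map.1 hD; exact mδ _
  have bYX (t) : ⁅Y, X t⁆ ∈ Submodule.span K ({Y} ∪ Set.range X ∪ Set.range δ) := by
    obtain ⟨t, rfl⟩ := t.mk_surjective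
    rw [hYX]; exact nsmul_mem (mX _) _
  have bYδ (t) : ⁅Y, δ t⁆ ∈ Submodule.span K ({Y} ∪ Set.range X ∪ Set.range δ) := by
    obtain ⟨t, rfl⟩ := t.mk_surjective
    rw [hYδ]; exact nsmul_mem (mδ _) _
  have bXδ (s t) : ⁅X s, δ t⁆ ∈ Submodule.span K ({Y} ∪ Set.range X ∪ Set.range δ) := by
    obtain ⟨s, rfl⟩ := s.mk_surjective
    obtain ⟨t, rfl⟩ := t.mk_surjective
    rw [hXδ]; exact sδ _
  apply le_antisymm
  -- By bilinearity, closure needs checking only on pairs of generators: nine cases, up to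
  -- skew-symmetry those given by the relations.
  · let S : LieSubalgebra K L :=
      { Submodule.span K ({Y} ∪ Set.range X ∪ Set.range δ) with
        lie_mem' := fun hx hy => by
          refine lie_mem_span_of_forall ?_ hx hy
          rintro _ ((rfl | ⟨s, rfl⟩) | ⟨s, rfl⟩) _ ((rfl | ⟨t, rfl⟩) | ⟨t, rfl⟩)
          · rw [lie_self]; exact zero_mem _
          · exact bYX t
          · exact bYδ t
          · exact lie_mem_comm (bYX s)
          · obtain ⟨s, rfl⟩ := s.mk_surjective
            obtain ⟨t, rfl⟩ := t.mk_surjective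
            rw [hXX]; exact sub_mem (sX _) (sX _)
          · exact bXδ s t
          · exact lie_mem_comm (bYδ s)
          · exact lie_mem_comm (bXδ t s)
          · obtain ⟨s, rfl⟩ := s.mk_surjective
            obtain ⟨t, rfl⟩ := t.mk_surjective
            rw [hδδ]; exact zero_mem _ }
    have h : LieSubalgebra.lieSpan K L ({Y} ∪ Set.range X ∪ {δ .bullet}) ≤ S :=
      LieSubalgebra.lieSpan_le.2 (Set.Subset.trans (Set.union_subset_union_right _
        (Set.singleton_subset_iff.2 (Set.mem_range_self _))) Submodule.subset_span)
    exact h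
  · refine Submodule.span_le.2 ?_
    rintro _ (h | ⟨t, rfl⟩)
    · exact LieSubalgebra.subset_lieSpan (.inl h)
    · refine Submodule.span_le.2 ?_ (mem_span_iterated_lie (K := K) hXδ t)
      rintro _ ⟨ts, rfl⟩
      induction ts with
      | nil => exact LieSubalgebra.subset_lieSpan (.inr rfl)
      | cons s ts ih =>
        exact LieSubalgebra.lie_mem _ (LieSubalgebra.subset_lieSpan (.inl (.inr ⟨s, rfl⟩))) ih

end Grafting

end TreeLie

/-! ### Commutators of the operators -/

namespace TreeLie.Patch

section Commutators

variable {M : Patch} {𝕜 : Type*} [RCLike 𝕜]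

theorem Alg.contDiff (a : M.Alg 𝕜) (ψ : M.LocDiff) : ContDiff ℝ ∞ (a.1 ψ) := (a.2.2 ψ).1

/-- An operator on `𝒜` is determined by its values over the domains of the lifts. -/
theorem end_ext {A B : Module.End 𝕜 (M.Alg 𝕜)}
    (h : ∀ (a : M.Alg 𝕜) (ψ : M.LocDiff), ∀ p ∈ ψ.liftDom, (A a).1 ψ p = (B a).1 ψ p) :
    A = B := by
  refine LinearMap.ext fun a => Subtype.ext (funext fun ψ => funext fun p => ?_)
  by_cases hp : p ∈ ψ.liftDom
  · exact h a ψ p hp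
  · rw [image_eq_zero_of_notMem_tsupport fun hs => hp (((A a).2.2 ψ).2.2 hs),
      image_eq_zero_of_notMem_tsupport fun hs => hp (((B a).2.2 ψ).2.2 hs)]

theorem opY_apply (a : M.Alg 𝕜) (ψ : M.LocDiff) : (M.opY 𝕜 a).1 ψ = dZ (a.1 ψ) := rfl

theorem opX_apply (t : PTree) (a : M.Alg 𝕜) (ψ : M.LocDiff) :
    (M.opX 𝕜 (RTree.mk t) a).1 ψ = fun p => fderiv ℝ (a.1 ψ) p (M.field t p) := by
  funext p
  rw [field, fderiv_apply_mk]
  rfl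

theorem opDelta_apply (t : PTree) (a : M.Alg 𝕜) (ψ : M.LocDiff) :
    (M.opDelta 𝕜 (RTree.mk t) a).1 ψ = fun p => M.pphi t ψ.gammaBullet p • a.1 ψ p := rfl

theorem bracket_apply (A B : Module.End 𝕜 (M.Alg 𝕜)) (a : M.Alg 𝕜) (ψ : M.LocDiff)
    (p : ℝ × ℝ) : (⁅A, B⁆ a).1 ψ p = (A (B a)).1 ψ p - (B (A a)).1 ψ p := rfl

theorem list_sum_apply {α : Type*} (l : List α) (F : α → Module.End 𝕜 (M.Alg 𝕜))
    (a : M.Alg 𝕜) (ψ : M.LocDiff) (p : ℝ × ℝ) :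
    ((l.map F).sum a).1 ψ p = (l.map fun u => (F u a).1 ψ p).sum := by
  induction l with
  | nil => rfl
  | cons u l ih => rw [List.map_cons, List.sum_cons, List.map_cons, List.sum_cons, ← ih]; rfl

theorem differentiableAt_field (ψ : M.LocDiff) (t : PTree) {p : ℝ × ℝ} (hp : p ∈ ψ.liftDom) :
    DifferentiableAt ℝ (M.field t) p :=
  (differentiableAt_pphi ψ.isOpen_liftDom ψ.liftDom_subset t (contDiffOn_phiBulletX _) hp).prodMk
    (differentiableAt_pphi ψ.isOpen_liftDom ψ.liftDom_subset t
      (contDiffOn_phiBulletZ ψ.liftDom_subset) hp)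

theorem fderiv_field_apply (ψ : M.LocDiff) (t : PTree) {p : ℝ × ℝ} (hp : p ∈ ψ.liftDom)
    (v : ℝ × ℝ) : fderiv ℝ (M.field t) p v
      = (fderiv ℝ (M.pphi t phiBulletX) p v, fderiv ℝ (M.pphi t M.phiBulletZ) p v) := by
  have h1 := (differentiableAt_pphi ψ.isOpen_liftDom ψ.liftDom_subset t
    (contDiffOn_phiBulletX _) hp).hasFDerivAt
  have h2 := (differentiableAt_pphi ψ.isOpen_liftDom ψ.liftDom_subset t
    (contDiffOn_phiBulletZ ψ.liftDom_subset) hp).hasFDerivAt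
  have h3 : HasFDerivAt (M.field t) _ p := h1.prodMk h2
  rw [h3.fderiv]
  rfl

/-- The grafting identity for both components at once: differentiating one tree field along another
is the pre-Lie product given by grafting. -/
theorem fderiv_field_field (ψ : M.LocDiff) (s t : PTree) {p : ℝ × ℝ} (hp : p ∈ ψ.liftDom) :
    fderiv ℝ (M.field t) p (M.field s p) = ((s.graft t).map fun u => M.field u p).sum := by
  rw [fderiv_field_apply ψ t hp,
    fderiv_pphi_field ψ.isOpen_liftDom ψ.liftDom_subset s hp t _ (contDiffOn_phiBulletX _),
    fderiv_pphi_field ψ.isOpen_liftDom ψ.liftDom_subset s hp t _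
      (contDiffOn_phiBulletZ ψ.liftDom_subset)]
  induction s.graft t with
  | nil => rfl
  | cons u l ih => rw [List.map_cons, List.map_cons, List.map_cons, List.sum_cons, List.sum_cons,
      List.sum_cons, ← ih]; rfl

theorem map_list_sum_field (L : ℝ × ℝ →L[ℝ] 𝕜) (l : List PTree) (p : ℝ × ℝ) :
    L (l.map fun u => M.field u p).sum = (l.map fun u => L (M.field u p)).sum := by
  rw [map_list_sum, List.map_map]
  rfl

/-- The second derivatives of the coefficient cancel by symmetry; what is left is the derivative
along the difference of the two grafting sums. -/
theorem bracket_opX_opX (s t : PTree) :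
    ⁅M.opX 𝕜 (RTree.mk s), M.opX 𝕜 (RTree.mk t)⁆
      = ((s.graft t).map fun u => M.opX 𝕜 (RTree.mk u)).sum
        - ((t.graft s).map fun u => M.opX 𝕜 (RTree.mk u)).sum := by
  refine end_ext fun a ψ p hp => ?_
  refine Eq.trans ?_ (congrArg₂ (· - ·) (list_sum_apply _ _ a ψ p).symm
    (list_sum_apply _ _ a ψ p).symm)
  simp only [bracket_apply, opX_apply]
  rw [fderiv_fderiv_sub (Alg.contDiff a ψ).contDiffAt (differentiableAt_field ψ s hp)
    (differentiableAt_field ψ t hp), fderiv_field_field ψ s t hp, fderiv_field_field ψ t s hp,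
    map_sub, map_list_sum_field, map_list_sum_field]

theorem fderiv_smul_apply (ψ : M.LocDiff) {g : ℝ × ℝ → ℝ} (hg : ContDiffOn ℝ ∞ g ψ.liftDom)
    (a : M.Alg 𝕜) {p : ℝ × ℝ} (hp : p ∈ ψ.liftDom) (v : ℝ × ℝ) :
    fderiv ℝ (fun q => g q • a.1 ψ q) p v
      = g p • fderiv ℝ (a.1 ψ) p v + fderiv ℝ g p v • a.1 ψ p := by
  have h1 := ((hg.contDiffAt (ψ.isOpen_liftDom.mem_nhds hp)).differentiableAt
    (by simp)).hasFDerivAt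
  have h2 := ((Alg.contDiff a ψ).differentiable (by simp) p).hasFDerivAt
  rw [(h1.fun_smul h2).fderiv]
  rfl

/-- By the Leibniz rule, the commutator of a derivation with multiplication by `γ_t(ψ)` is
multiplication by the derivative of `γ_t(ψ)`. -/
theorem bracket_opX_opDelta (s t : PTree) :
    ⁅M.opX 𝕜 (RTree.mk s), M.opDelta 𝕜 (RTree.mk t)⁆
      = ((s.graft t).map fun u => M.opDelta 𝕜 (RTree.mk u)).sum := by
  refine end_ext fun a ψ p hp => ?_
  rw [list_sum_apply]
  simp only [bracket_apply, opX_apply, opDelta_apply]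
  rw [fderiv_smul_apply ψ (contDiffOn_pphi ψ.isOpen_liftDom ψ.liftDom_subset t _
      ψ.contDiffOn_gammaBullet) a hp, add_sub_cancel_left,
    fderiv_pphi_field ψ.isOpen_liftDom ψ.liftDom_subset s hp t _ ψ.contDiffOn_gammaBullet,
    List.sum_smul, List.map_map]
  rfl

theorem bracket_opY_opX (t : PTree) :
    ⁅M.opY 𝕜, M.opX 𝕜 (RTree.mk t)⁆ = t.size • M.opX 𝕜 (RTree.mk t) := by
  refine end_ext fun a ψ p hp => ?_
  change _ = t.size • (M.opX 𝕜 (RTree.mk t) a).1 ψ p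
  simp only [bracket_apply, opX_apply, opY_apply]
  -- `Y` is the derivative along the constant field `(0, 1)`, so the commutator formula for vector
  -- fields applies to it as well.
  have hsub := fderiv_fderiv_sub (Alg.contDiff a ψ).contDiffAt
    (differentiableAt_const ((0 : ℝ), (1 : ℝ))) (differentiableAt_field ψ t hp)
  have i1 := dZ_pphi ψ.isOpen_liftDom ψ.liftDom_subset hp t _ (contDiffOn_phiBulletX _)
    fun q _ => dZ_phiBulletX q
  have i2 := dZ_pphi ψ.isOpen_liftDom ψ.liftDom_subset hp t _
    (contDiffOn_phiBulletZ ψ.liftDom_subset) fun q hq => dZ_phiBulletZ (ψ.liftDom_subset hq).1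
  have e : fderiv ℝ (M.field t) p (0, 1) = t.size • M.field t p := by
    rw [fderiv_field_apply ψ t hp]
    simp only [dZ] at i1 i2
    rw [i1, i2, field, ← Nat.cast_smul_eq_nsmul ℝ]
    rfl
  refine hsub.trans ?_
  rw [e, fderiv_fun_const, Pi.zero_apply, zero_apply, sub_zero, map_nsmul]

theorem bracket_opY_opDelta (t : PTree) :
    ⁅M.opY 𝕜, M.opDelta 𝕜 (RTree.mk t)⁆ = t.size • M.opDelta 𝕜 (RTree.mk t) := by
  refine end_ext fun a ψ p hp => ?_
  change _ = t.size • (M.opDelta 𝕜 (RTree.mk t) a).1 ψ p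
  simp only [bracket_apply, opDelta_apply, opY_apply]
  have i := dZ_pphi ψ.isOpen_liftDom ψ.liftDom_subset hp t _ ψ.contDiffOn_gammaBullet
    ψ.dZ_gammaBullet
  simp only [dZ] at i ⊢
  rw [fderiv_smul_apply ψ (contDiffOn_pphi ψ.isOpen_liftDom ψ.liftDom_subset t _
      ψ.contDiffOn_gammaBullet) a hp, add_sub_cancel_left, i, mul_smul,
    Nat.cast_smul_eq_nsmul]

theorem bracket_opDelta_opDelta (s t : PTree) :
    ⁅M.opDelta 𝕜 (RTree.mk s), M.opDelta 𝕜 (RTree.mk t)⁆ = 0 := by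
  refine end_ext fun a ψ p _ => ?_
  change _ = (0 : 𝕜)
  simp only [bracket_apply, opDelta_apply]
  rw [smul_comm, sub_self]

end Commutators

end TreeLie.Patch

theorem mainTheorem8 (𝕜 : Type*) [RCLike 𝕜] (K : Type*) [Field K] [Algebra K 𝕜]
    (M : TreeLie.Patch) :
    (LieSubalgebra.lieSpan K (Module.End 𝕜 (M.Alg 𝕜))
        ({M.opY 𝕜} ∪ Set.range (M.opX 𝕜) ∪ {M.opDelta 𝕜 TreeLie.RTree.bullet})).toSubmodule
      = M.L1 𝕜 K ∧
    ∀ t : TreeLie.RTree,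
      M.opDelta 𝕜 t ∈ Submodule.span K (Set.range (M.iterBracket 𝕜)) :=
  ⟨TreeLie.lieSpan_eq_span_of_grafting (K := K) (L := Module.End 𝕜 (M.Alg 𝕜))
      TreeLie.Patch.bracket_opY_opX TreeLie.Patch.bracket_opY_opDelta
      TreeLie.Patch.bracket_opX_opX TreeLie.Patch.bracket_opX_opDelta
      TreeLie.Patch.bracket_opDelta_opDelta,
    TreeLie.mem_span_iterated_lie (K := K) (L := Module.End 𝕜 (M.Alg 𝕜))
      TreeLie.Patch.bracket_opX_opDelta⟩
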